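/- In the conditional sampling model, an algorithm accesses an unknown distribution $\mu$ over $[n]=\{1,\dots,n\}$ only by submitting non-empty sets $A\subseteq[n]$; it receives for each an independent sample of $\mu$ conditioned on $A$ (a uniformly random member of $A$ if $\mu(A)=0$). An adaptive algorithm with $t$ samples may choose each set depending on the earlier answers and on its coin tosses; a non-adaptive algorithm with at most $t$ samples fixes all its sets, depending only on its coin tosses, before it receives any answer. Given a set $\mathcal P$ of distributions over $[n]$, such a randomized algorithm $(\varepsilon,\delta)$-tests $\mathcal P$ if it accepts every $\mu\in\mathcal P$ with probability at least $1-\delta$, and rejects with probability at least $1-\delta$ every $\mu$ that is $\varepsilon$-far from $\mathcal P$, i.e. such that $\frac12\sum_{i=1}^n|\mu(i)-\mu'(i)|\ge\varepsilon$ for all $\mu'\in\mathcal P$. **Theorem.** There exist a property of distributions, that is, a set $\mathcal P_n$ of distributions over $[n]$ for every $n$, and constants $\varepsilon_0>0$, $c>0$ and $N$ such that for every $n\ge N$ the set $\mathcal P_n$ is not invariant under permutations of $[n]$, and for all $0<\varepsilon\le\varepsilon_0$ and $0<\delta\le\frac13$, every adaptive algorithm that $(\varepsilon,\delta)$-tests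 $\mathcal P_n$ with $t$ conditional samples, and every non-adaptive algorithm that $(\varepsilon,\delta)$-tests $\mathcal P_n$ with at most $t$ conditional samples, satisfies $t\ge cn$. In other words, testing this property requires $\Omega(n)$ conditional samples, adaptively or not. -/

import Mathlib

noncomputable section

namespace CondSampling

/-- Variation distance between two distributions over an `n`-element domain. -/
def variationDist {n : ℕ} (μ ν : PMF (Fin n)) : ℝ :=
  (1 / 2) * ∑ i, |(μ i).toReal - (ν i).toReal|

/-- `μ` is `ε`-far from the property `P`. -/
def IsFar {n : ℕ} (ε : ℝ) (μ : PMF (Fin n)) (P : Set (PMF (Fin n))) : Prop :=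
  ∀ ν ∈ P, ε ≤ variationDist μ ν

/-- `P` is invariant under permutations of the domain. -/
def LabelInvariant {n : ℕ} (P : Set (PMF (Fin n))) : Prop :=
  ∀ μ ∈ P, ∀ σ : Equiv.Perm (Fin n), μ.map σ ∈ P

/-- The sets that may be submitted to the conditional sampling oracle. -/
abbrev CondSet (n : ℕ) : Type := {A : Finset (Fin n) // A.Nonempty}

open Classical in
/-- The answer of the conditional sampling oracle of `μ` on the set `A`: a sample of `μ`
conditioned on `A` if `A` has positive probability, a uniform member of `A` otherwise. -/
def condOracle {n : ℕ} (μ : PMF (Fin n)) (A : CondSet n) : PMF (Fin n) :=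
  if h : ∃ a ∈ (A.1 : Set (Fin n)), a ∈ μ.support then μ.filter (A.1 : Set (Fin n)) h
  else PMF.uniformOfFinset A.1 A.2

/-- Deterministic adaptive algorithms making `t` conditional samples, as decision trees: a node
holds the set to be submitted and, for each answer, the rest of the algorithm; a leaf holds the
decision (`true` means accept). -/
inductive AdaptiveAlg (n : ℕ) : ℕ → Type
  | decide (b : Bool) : AdaptiveAlg n 0
  | sample {t : ℕ} (A : CondSet n) (next : Fin n → AdaptiveAlg n t) : AdaptiveAlg n (t + 1)

/-- The random decision of a deterministic adaptive algorithm on the distribution `μ`; all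
oracle answers use fresh randomness. -/
def AdaptiveAlg.run {n : ℕ} (μ : PMF (Fin n)) : {t : ℕ} → AdaptiveAlg n t → PMF Bool
  | _, .decide b => PMF.pure b
  | _, .sample A next => (condOracle μ A).bind fun j => (next j).run μ

/-- Deterministic non-adaptive algorithms making at most `t` conditional samples: all sets are
fixed in advance, and the decision is a function of all the answers. -/
structure NonadaptiveAlg (n t : ℕ) : Type where
  numSamples : ℕ
  numSamples_le : numSamples ≤ t
  sets : Fin numSamples → CondSet n
  decide : (Fin numSamples → Fin n) → Bool

/-- The joint law of independent oracle answers on the sets `A 0, …, A (m - 1)`. -/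
def sampleAll {n : ℕ} (μ : PMF (Fin n)) : {m : ℕ} → (Fin m → CondSet n) → PMF (Fin m → Fin n)
  | 0, _ => PMF.pure Fin.elim0
  | _ + 1, A => (condOracle μ (A 0)).bind fun j =>
      (sampleAll μ (Fin.tail A)).map fun js => Fin.cons j js

/-- The random decision of a deterministic non-adaptive algorithm on the distribution `μ`. -/
def NonadaptiveAlg.run {n t : ℕ} (μ : PMF (Fin n)) (T : NonadaptiveAlg n t) : PMF Bool :=
  (sampleAll μ T.sets).map T.decide

/-- The requirement on the (random) decision of an `ε`-tester for `P` with error probability `δ`;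
`D μ` is the law of the decision when the oracle is that of `μ`. -/
def DecidesProperty {n : ℕ} (P : Set (PMF (Fin n))) (ε δ : ℝ) (D : PMF (Fin n) → PMF Bool) :
    Prop :=
  (∀ μ ∈ P, 1 - δ ≤ (D μ true).toReal) ∧ (∀ μ, IsFar ε μ P → 1 - δ ≤ (D μ false).toReal)

/-- A randomized adaptive algorithm `T` making `t` conditional samples tests `P`. The coin tosses
select a deterministic algorithm. There are only finitely many of these for given `n` and `t`, so
that every source of coin tosses amounts to an element `T` of this type. -/
def IsAdaptiveTester {n t : ℕ} (P : Set (PMF (Fin n))) (ε δ : ℝ) (T : PMF (AdaptiveAlg n t)) :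
    Prop :=
  DecidesProperty P ε δ fun μ => T.bind fun a => a.run μ

/-- A randomized non-adaptive algorithm `T` making at most `t` conditional samples tests `P`. The
coin tosses select a deterministic non-adaptive algorithm, that is, the sets and the decision
rule; again there are only finitely many of these. -/
def IsNonadaptiveTester {n t : ℕ} (P : Set (PMF (Fin n))) (ε δ : ℝ)
    (T : PMF (NonadaptiveAlg n t)) : Prop :=
  DecidesProperty P ε δ fun μ => T.bind fun a => a.run μ

end CondSampling

end

noncomputable section

namespace CondSampling

open Finset
open scoped symmDiff

variable {n : ℕ}

/-! ### Two-level distributions -/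

/-! The hard inputs are the distributions `twoLevel x` with `x.card = n / 2`. Rejection sampling
with acceptance probability 1 or 1/2 simulates a conditional sample, and each attempt looks at one
bit of `x`. Hence a tester with `t` samples has, up to error `2 ^ t * (3 / 4) ^ q`, an acceptance
probability of degree at most `q` in the bits of `x` (`exists_lowDegree_approx`).

By Carathéodory, a weighted average over a small family `S` matches the uniform average over all `x`
of size `n / 2` on every function of degree at most `q = n / 16`
(`exists_small_support_of_lowDegree`). The property is the image of `S`. By counting, at most a
tenth of all `x` lie near `S` (`ten_mul_card_nearby_le`), and the others give far distributions. A
tester must accept with probability at least 2/3 on average over `S` but rarely on average over all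
`x`, so `t` must be linear in `n`. -/

/-- The weight function with value `2` on `x` and value `1` outside of `x`. -/
def weight (x : Finset (Fin n)) (j : Fin n) : ℝ := if j ∈ x then 2 else 1

theorem one_le_weight (x : Finset (Fin n)) (j : Fin n) : 1 ≤ weight x j := by
  unfold weight; split_ifs <;> norm_num

theorem weight_le_two (x : Finset (Fin n)) (j : Fin n) : weight x j ≤ 2 := by
  unfold weight; split_ifs <;> norm_num

theorem weight_pos (x : Finset (Fin n)) (j : Fin n) : 0 < weight x j :=
  zero_lt_one.trans_le (one_le_weight x j)

theorem sum_weight_pos (x : Finset (Fin n)) (A : CondSet n) : 0 < ∑ j ∈ A.1, weight x j :=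
  sum_pos (fun j _ => weight_pos x j) A.2

theorem sum_weight_univ (x : Finset (Fin n)) : ∑ j, weight x j = n + x.card := by
  have h : ∀ j, weight x j = 1 + if j ∈ x then 1 else 0 := by
    intro j; unfold weight; split_ifs <;> norm_num
  simp [h, sum_add_distrib]

theorem sum_univ_weight_pos [NeZero n] (x : Finset (Fin n)) : 0 < ∑ j, weight x j :=
  sum_pos (fun j _ => weight_pos x j) univ_nonempty

/-- The distribution proportional to `weight x`. -/
def twoLevel [NeZero n] (x : Finset (Fin n)) : PMF (Fin n) :=
  PMF.ofFintype (fun j => ENNReal.ofReal (weight x j / ∑ i, weight x i)) (by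
    rw [← ENNReal.ofReal_sum_of_nonneg
      (fun j _ => div_nonneg (weight_pos x j).le (sum_univ_weight_pos x).le),
      ← sum_div, div_self (sum_univ_weight_pos x).ne', ENNReal.ofReal_one])

theorem toReal_twoLevel [NeZero n] (x : Finset (Fin n)) (j : Fin n) :
    (twoLevel x j).toReal = weight x j / ∑ i, weight x i :=
  ENNReal.toReal_ofReal (div_nonneg (weight_pos x j).le (sum_univ_weight_pos x).le)

theorem toReal_condOracle_twoLevel [NeZero n] (x : Finset (Fin n)) (A : CondSet n) (j : Fin n) :
    (condOracle (twoLevel x) A j).toReal =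
      if j ∈ A.1 then weight x j / ∑ i ∈ A.1, weight x i else 0 := by
  -- Full support rules out the uniform fallback of the oracle.
  have hsupp : ∀ i, i ∈ (twoLevel x).support := fun i => by
    rw [PMF.mem_support_iff]
    intro h0
    have := toReal_twoLevel x i
    rw [h0, ENNReal.toReal_zero] at this
    exact (div_pos (weight_pos x i) (sum_univ_weight_pos x)).ne this
  have hex : ∃ a ∈ (A.1 : Set (Fin n)), a ∈ (twoLevel x).support := by
    obtain ⟨a, ha⟩ := A.2
    exact ⟨a, ha, hsupp a⟩
  rw [condOracle, dif_pos hex, PMF.filter_apply, tsum_fintype, ENNReal.toReal_mul,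
    ENNReal.toReal_inv, ENNReal.toReal_sum]
  · have hW := (sum_univ_weight_pos x).ne'
    have hA := (sum_weight_pos x A).ne'
    have hind : ∀ i, ((A.1 : Set (Fin n)).indicator (twoLevel x) i).toReal =
        if i ∈ A.1 then weight x i / ∑ k, weight x k else 0 := by
      intro i
      by_cases hi : i ∈ A.1
      · rw [if_pos hi, Set.indicator_of_mem (by exact hi), toReal_twoLevel]
      · rw [if_neg hi, Set.indicator_of_notMem (by exact hi), ENNReal.toReal_zero]
    simp only [hind, sum_ite_mem, univ_inter, ← sum_div]
    split_ifs
    · field_simp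
    · simp
  · intro i _
    by_cases hi : i ∈ A.1
    · rw [Set.indicator_of_mem (by exact hi)]; exact PMF.apply_ne_top _ _
    · rw [Set.indicator_of_notMem (by exact hi)]; exact ENNReal.zero_ne_top

theorem variationDist_twoLevel [NeZero n] {x y : Finset (Fin n)} (h : x.card = y.card) :
    variationDist (twoLevel x) (twoLevel y) = (x ∆ y).card / (2 * (n + x.card)) := by
  have hW : (0 : ℝ) < n + x.card := sum_weight_univ x ▸ sum_univ_weight_pos x
  have hterm : ∀ i, |(twoLevel x i).toReal - (twoLevel y i).toReal| =
      (if i ∈ x ∆ y then 1 else 0) / ((n : ℝ) + x.card) := by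
    intro i
    rw [toReal_twoLevel, toReal_twoLevel, sum_weight_univ, sum_weight_univ, ← h, ← sub_div,
      abs_div, abs_of_pos hW]
    congr 1
    by_cases hx : i ∈ x <;> by_cases hy : i ∈ y <;> norm_num [weight, mem_symmDiff, hx, hy]
  rw [variationDist, sum_congr rfl fun i _ => hterm i, ← sum_div]
  simp
  field_simp

theorem map_twoLevel [NeZero n] (x : Finset (Fin n)) (σ : Equiv.Perm (Fin n)) :
    (twoLevel x).map σ = twoLevel (x.map σ.toEmbedding) := by
  ext j
  obtain ⟨i, rfl⟩ := σ.surjective j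
  rw [PMF.map_apply, tsum_eq_single i]
  · rw [if_pos rfl]
    change ENNReal.ofReal _ = ENNReal.ofReal _
    rw [sum_weight_univ, sum_weight_univ, card_map]
    simp [weight]
  · intro i' hi'
    rw [if_neg fun h => hi' (σ.injective h.symm)]

/-! ### Acceptance probabilities -/

theorem toReal_bind_apply {α β : Type*} (p : PMF α) (f : α → PMF β) (b : β) :
    (p.bind f b).toReal = ∑' a, (p a).toReal * (f a b).toReal := by
  rw [PMF.bind_apply, ENNReal.tsum_toReal_eq]
  · simp only [ENNReal.toReal_mul]
  · exact fun a => ENNReal.mul_ne_top (PMF.apply_ne_top _ _) (PMF.apply_ne_top _ _)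

theorem toReal_apply_le_one {α : Type*} (p : PMF α) (a : α) : (p a).toReal ≤ 1 :=
  ENNReal.toReal_le_of_le_ofReal zero_le_one (by simpa using p.coe_le_one a)

theorem summable_toReal {α : Type*} (p : PMF α) : Summable fun a => (p a).toReal :=
  ENNReal.summable_toReal p.tsum_coe_ne_top

theorem tsum_toReal {α : Type*} (p : PMF α) : ∑' a, (p a).toReal = 1 := by
  rw [← ENNReal.tsum_toReal_eq fun a => p.apply_ne_top a, p.tsum_coe, ENNReal.toReal_one]

theorem toReal_true_add_toReal_false (p : PMF Bool) : (p true).toReal + (p false).toReal = 1 := by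
  rw [← tsum_toReal p, tsum_fintype, Fintype.sum_bool]

/-- The probability that a deterministic adaptive algorithm accepts `twoLevel x`. -/
def acceptProb [NeZero n] {t : ℕ} (T : AdaptiveAlg n t) (x : Finset (Fin n)) : ℝ :=
  (T.run (twoLevel x) true).toReal

theorem sum_weight_mul_acceptProb_sample [NeZero n] {t : ℕ} (A : CondSet n)
    (next : Fin n → AdaptiveAlg n t) (x : Finset (Fin n)) :
    (∑ j ∈ A.1, weight x j) * acceptProb (.sample A next) x =
      ∑ j ∈ A.1, weight x j * acceptProb (next j) x := by
  have hA := (sum_weight_pos x A).ne'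
  rw [acceptProb, AdaptiveAlg.run, toReal_bind_apply, tsum_fintype]
  simp only [toReal_condOracle_twoLevel, ite_mul, zero_mul, sum_ite_mem, univ_inter, mul_sum,
    acceptProb]
  refine sum_congr rfl fun j _ => ?_
  field_simp

/-- One step of rejection sampling: a uniform member `j` of `A` is kept as the answer with
probability `weight x j / 2`, otherwise the sampling starts again. -/
theorem acceptProb_sample [NeZero n] {t : ℕ} (A : CondSet n) (next : Fin n → AdaptiveAlg n t)
    (x : Finset (Fin n)) :
    acceptProb (.sample A next) x = (A.1.card : ℝ)⁻¹ * ∑ j ∈ A.1,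
      (weight x j / 2 * acceptProb (next j) x +
        (1 - weight x j / 2) * acceptProb (.sample A next) x) := by
  have hc : (A.1.card : ℝ) ≠ 0 := by exact_mod_cast A.2.card_pos.ne'
  have h := sum_weight_mul_acceptProb_sample A next x
  have hsum : ∑ j ∈ A.1, (weight x j / 2 * acceptProb (next j) x +
      (1 - weight x j / 2) * acceptProb (.sample A next) x) =
      (∑ j ∈ A.1, weight x j * acceptProb (next j) x) / 2 +
        (A.1.card - (∑ j ∈ A.1, weight x j) / 2) * acceptProb (.sample A next) x := by
    have hj : ∀ j, weight x j / 2 * acceptProb (next j) x =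
        weight x j * acceptProb (next j) x / 2 := fun j => by ring
    simp only [sum_add_distrib, ← sum_mul, sum_sub_distrib, sum_const, nsmul_eq_mul, mul_one,
      hj, ← sum_div]
  rw [hsum, ← h]
  field_simp
  ring

/-! ### Functions of low degree -/

/-- The indicator function of the property of containing `S`. -/
def monomial (S x : Finset (Fin n)) : ℝ := if S ⊆ x then 1 else 0

/-- The functions of a subset of `Fin n` that are polynomials of degree at most `q` in the
indicator variables of its elements. -/
def lowDegree (n q : ℕ) : Submodule ℝ (Finset (Fin n) → ℝ) :=
  Submodule.span ℝ (monomial '' {S | S.card ≤ q})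

theorem lowDegree_mono {q r : ℕ} (h : q ≤ r) : lowDegree n q ≤ lowDegree n r :=
  Submodule.span_mono (Set.image_mono fun _ hS => le_trans hS h)

theorem const_mem_lowDegree (q : ℕ) (a : ℝ) : (fun _ => a) ∈ lowDegree n q := by
  have h : (monomial ∅ : Finset (Fin n) → ℝ) ∈ lowDegree n q :=
    Submodule.subset_span ⟨∅, by simp, rfl⟩
  convert Submodule.smul_mem _ a h using 1
  ext x
  simp [monomial]

theorem weight_mul_mem_lowDegree {q : ℕ} {f : Finset (Fin n) → ℝ} (hf : f ∈ lowDegree n q)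
    (j : Fin n) : (fun x => weight x j * f x) ∈ lowDegree n (q + 1) := by
  induction hf using Submodule.span_induction with
  | mem f hf =>
    obtain ⟨S, hS, rfl⟩ := hf
    have h₁ : monomial S ∈ lowDegree n (q + 1) :=
      Submodule.subset_span ⟨S, le_trans hS q.le_succ, rfl⟩
    have h₂ : monomial (insert j S) ∈ lowDegree n (q + 1) :=
      Submodule.subset_span ⟨_, (card_insert_le j S).trans (Nat.succ_le_succ hS), rfl⟩
    convert Submodule.add_mem _ h₁ h₂ using 1
    ext x
    by_cases hj : j ∈ x <;> by_cases hx : S ⊆ x <;>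
      norm_num [monomial, weight, insert_subset_iff, hj, hx]
  | zero => simpa using const_mem_lowDegree (q + 1) 0
  | add f g _ _ hf hg =>
    convert Submodule.add_mem _ hf hg using 1
    ext x
    simp [mul_add]
  | smul a f _ hf =>
    convert Submodule.smul_mem _ a hf using 1
    ext x
    simp [mul_left_comm]

/-- Rejection sampling with at most `q` attempts in total approximates the acceptance probability
from below by a function of degree at most `q`. -/
theorem exists_lowDegree_approx [NeZero n] (q : ℕ) : ∀ {t : ℕ} (T : AdaptiveAlg n t),
    ∃ f ∈ lowDegree n q, ∀ x, f x ≤ acceptProb T x ∧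
      acceptProb T x ≤ f x + 2 ^ t * (3 / 4) ^ q := by
  induction q with
  | zero =>
    intro t T
    refine ⟨0, Submodule.zero_mem _, fun x => ⟨ENNReal.toReal_nonneg, ?_⟩⟩
    have h : (1 : ℝ) ≤ 2 ^ t := one_le_pow₀ one_le_two
    rw [Pi.zero_apply, zero_add, pow_zero, mul_one]
    exact (toReal_apply_le_one _ _).trans h
  | succ q ih =>
    intro t T
    cases T with
    | decide b =>
      refine ⟨_, const_mem_lowDegree _ (if b then 1 else 0), fun x => ?_⟩
      have h : acceptProb (.decide b) x = if b then 1 else 0 := by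
        cases b <;> simp [acceptProb, AdaptiveAlg.run]
      rw [h]
      exact ⟨le_rfl, le_add_of_nonneg_right (by positivity)⟩
    | @sample t A next =>
      -- One attempt is spent in either case: a success moves to `next j`, a failure stays at the
      -- same node. Hence the induction is on `q`, for all trees at once.
      choose g hg hgx using fun j => ih (next j)
      obtain ⟨f, hf, hfx⟩ := ih (.sample A next)
      refine ⟨fun x => (A.1.card : ℝ)⁻¹ * ∑ j ∈ A.1,
        (weight x j / 2 * g j x + (1 - weight x j / 2) * f x), ?_, fun x => ?_⟩
      · have hmem : (A.1.card : ℝ)⁻¹ • ∑ j ∈ A.1, ((1 / 2 : ℝ) • (fun x => weight x j * g j x) +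
            (f - (1 / 2 : ℝ) • fun x => weight x j * f x)) ∈ lowDegree n (q + 1) :=
          Submodule.smul_mem _ _ <| Submodule.sum_mem _ fun j _ => Submodule.add_mem _
            (Submodule.smul_mem _ _ (weight_mul_mem_lowDegree (hg j) j))
            (Submodule.sub_mem _ (lowDegree_mono q.le_succ hf)
              (Submodule.smul_mem _ _ (weight_mul_mem_lowDegree hf j)))
        convert hmem using 1
        ext x
        simp only [Pi.smul_apply, Finset.sum_apply, Pi.add_apply, Pi.sub_apply, smul_eq_mul]
        congr 1
        exact sum_congr rfl fun j _ => by ring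
      · have hc : (0 : ℝ) < A.1.card := by exact_mod_cast A.2.card_pos
        rw [acceptProb_sample A next x]
        constructor
        · refine mul_le_mul_of_nonneg_left (sum_le_sum fun j _ => ?_) (inv_pos.2 hc).le
          exact add_le_add
            (mul_le_mul_of_nonneg_left (hgx j x).1 (div_nonneg (weight_pos x j).le zero_le_two))
            (mul_le_mul_of_nonneg_left (hfx x).1 (by linarith [weight_le_two x j]))
        · have hB : (0 : ℝ) ≤ 2 ^ t * (3 / 4) ^ q := by positivity
          -- With success probability `p ≥ 1 / 2`, the error factor becomes `p * 2 ^ t + (1 - p) * 2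
          -- ^ (t + 1)`, which is at most `3 / 4` of `2 ^ (t + 1)`.
          have hj : ∀ j ∈ A.1, weight x j / 2 * acceptProb (next j) x +
              (1 - weight x j / 2) * acceptProb (.sample A next) x ≤
              (weight x j / 2 * g j x + (1 - weight x j / 2) * f x) +
                2 ^ (t + 1) * (3 / 4) ^ (q + 1) := by
            intro j _
            have h₁ := (hgx j x).2
            have h₂ := (hfx x).2
            rw [pow_succ] at h₂ ⊢
            rw [pow_succ]
            by_cases hx : j ∈ x <;> simp only [weight, hx, if_true, if_false] <;> linarith
          calc _ ≤ (A.1.card : ℝ)⁻¹ * ∑ j ∈ A.1,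
                ((weight x j / 2 * g j x + (1 - weight x j / 2) * f x) +
                  2 ^ (t + 1) * (3 / 4) ^ (q + 1)) :=
                mul_le_mul_of_nonneg_left (sum_le_sum hj) (inv_pos.2 hc).le
            _ = _ := by
                rw [sum_add_distrib, sum_const, nsmul_eq_mul, mul_add,
                  inv_mul_cancel_left₀ hc.ne']

/-! ### Non-adaptive algorithms as decision trees -/

/-- The decision tree that asks for the sets `A` one after the other. -/
def treeOfSets : {m : ℕ} → (Fin m → CondSet n) → ((Fin m → Fin n) → Bool) → AdaptiveAlg n m
  | 0, _, d => .decide (d Fin.elim0)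
  | _ + 1, A, d => .sample (A 0) fun j => treeOfSets (Fin.tail A) fun js => d (Fin.cons j js)

theorem run_treeOfSets (μ : PMF (Fin n)) : ∀ {m : ℕ} (A : Fin m → CondSet n)
    (d : (Fin m → Fin n) → Bool), (treeOfSets A d).run μ = (sampleAll μ A).map d
  | 0, _, d => by simp [treeOfSets, AdaptiveAlg.run, sampleAll, PMF.pure_map]
  | m + 1, A, d => by
    simp only [treeOfSets, AdaptiveAlg.run, sampleAll, PMF.map_bind, PMF.map_comp]
    congr 1
    ext1 j
    exact run_treeOfSets μ _ _

/-! ### A small set with the low-degree moments of a large one -/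

/-- Carathéodory: the mean of the points `φ x` is a convex combination of affinely independent ones,
of which there are at most the dimension plus one. -/
theorem exists_small_support_of_mean {α ι : Type*} [Fintype ι] (φ : α → ι → ℝ)
    {M : Finset α} (hM : M.Nonempty) :
    ∃ S ⊆ M, S.card ≤ Fintype.card ι + 1 ∧ ∃ c : α → ℝ, (∀ x ∈ S, 0 ≤ c x) ∧ ∑ x ∈ S, c x = 1 ∧
      ∀ i, ∑ x ∈ S, c x * φ x i = (M.card : ℝ)⁻¹ * ∑ x ∈ M, φ x i := by
  classical
  have hc : (M.card : ℝ) ≠ 0 := by exact_mod_cast hM.card_pos.ne'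
  have hmem : M.centerMass (fun _ => (1 : ℝ)) φ ∈ convexHull ℝ (φ '' M) :=
    M.centerMass_mem_convexHull (fun _ _ => zero_le_one) (by simpa using hM)
      fun x hx => ⟨x, hx, rfl⟩
  obtain ⟨κ, _, z, w, hz, hind, hw, hw1, hwz⟩ := eq_pos_convex_span_of_mem_convexHull hmem
  choose g hgM hg using fun i => hz ⟨i, rfl⟩
  have hinj : Function.Injective g := fun i j hij => hind.injective (by rw [← hg, ← hg, hij])
  refine ⟨univ.image g, ?_, ?_, Function.extend g w 0, ?_, ?_, fun i => ?_⟩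
  · intro x hx
    obtain ⟨i, -, rfl⟩ := mem_image.1 hx
    exact hgM i
  · refine card_image_le.trans (hind.card_le_finrank_succ.trans (Nat.succ_le_succ ?_))
    exact (Submodule.finrank_le _).trans (Module.finrank_fintype_fun_eq_card ℝ).le
  · intro x hx
    obtain ⟨i, -, rfl⟩ := mem_image.1 hx
    rw [hinj.extend_apply]
    exact (hw i).le
  · rw [sum_image hinj.injOn]
    simpa [hinj.extend_apply] using hw1
  · rw [sum_image hinj.injOn]
    have := congrFun hwz i
    simpa [hinj.extend_apply, hg, Finset.centerMass, Finset.sum_apply] using this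

/-- The number of subsets of `Fin n` with at most `k` elements. -/
def ballCard (n k : ℕ) : ℕ := (univ.filter fun z : Finset (Fin n) => z.card ≤ k).card

theorem exists_small_support_of_lowDegree (q : ℕ) {M : Finset (Finset (Fin n))}
    (hM : M.Nonempty) :
    ∃ S ⊆ M, S.card ≤ ballCard n q + 1 ∧
      ∃ c : Finset (Fin n) → ℝ, (∀ x ∈ S, 0 ≤ c x) ∧ ∑ x ∈ S, c x = 1 ∧
        ∀ f ∈ lowDegree n q, ∑ x ∈ S, c x * f x = (M.card : ℝ)⁻¹ * ∑ x ∈ M, f x := by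
  obtain ⟨S, hSM, hS, c, hc, hc1, hφ⟩ := exists_small_support_of_mean
    (fun x (R : {R : Finset (Fin n) // R.card ≤ q}) => monomial R.1 x) hM
  refine ⟨S, hSM, by rwa [Fintype.card_subtype] at hS, c, hc, hc1, fun f hf => ?_⟩
  induction hf using Submodule.span_induction with
  | mem f hf =>
    obtain ⟨R, hR, rfl⟩ := hf
    exact hφ ⟨R, hR⟩
  | zero => simp
  | add f g _ _ hf hg => simp [mul_add, sum_add_distrib, hf, hg]
  | smul a f _ hf =>
    simp only [Pi.smul_apply, smul_eq_mul, mul_left_comm _ a, ← mul_sum, hf]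

/-! ### Counting subsets close to a given family -/

/-- Weighting each set `z` by `8 ^ (n - z.card)` gives total `9 ^ n` by the binomial theorem. -/
theorem ballCard_mul_le {k : ℕ} : ballCard n k * 8 ^ (n - k) ≤ 9 ^ n := by
  calc ballCard n k * 8 ^ (n - k)
      = ∑ z ∈ univ.filter fun z : Finset (Fin n) => z.card ≤ k, 8 ^ (n - k) := by
        rw [sum_const, smul_eq_mul, ballCard]
    _ ≤ ∑ z ∈ univ.filter fun z : Finset (Fin n) => z.card ≤ k, 8 ^ (n - z.card) :=
        sum_le_sum fun z hz => Nat.pow_le_pow_right (by norm_num)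
          (Nat.sub_le_sub_left (mem_filter.1 hz).2 n)
    _ ≤ ∑ z : Finset (Fin n), 8 ^ (n - z.card) :=
        sum_le_sum_of_subset (filter_subset _ _)
    _ = 9 ^ n := by
        simpa using Fintype.sum_pow_mul_eq_add_pow (Fin n) (1 : ℕ) 8

/-- The square arises because `S` has about `ballCard` members, each with at most `ballCard`
neighbours; the factor `16 ^ (n / 16)` will absorb the loss `20 * (n + 1)`. -/
theorem ballCard_sq_mul_le (n : ℕ) : ballCard n (n / 16) ^ 2 * 16 ^ (n / 16) ≤ 2 ^ n := by
  have h := Nat.pow_le_pow_left (ballCard_mul_le (n := n) (k := n / 16)) 2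
  obtain ⟨r, hr⟩ : ∃ r, n = 16 * (n / 16) + r := ⟨n % 16, (Nat.div_add_mod n 16).symm⟩
  generalize ballCard n (n / 16) = V at h ⊢
  generalize n / 16 = k at h hr ⊢
  subst hr
  have hsub : 16 * k + r - k = 15 * k + r := by omega
  rw [hsub, mul_pow] at h
  refine Nat.le_of_mul_le_mul_right (c := (8 ^ (15 * k + r)) ^ 2) ?_ (by positivity)
  calc V ^ 2 * 16 ^ k * (8 ^ (15 * k + r)) ^ 2
      = V ^ 2 * (8 ^ (15 * k + r)) ^ 2 * 16 ^ k := by ring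
    _ ≤ (9 ^ (16 * k + r)) ^ 2 * 16 ^ k := Nat.mul_le_mul_right _ h
    _ = (9 ^ 32 * 16) ^ k * 81 ^ r := by
        rw [mul_pow, ← pow_mul, ← pow_mul, show (16 * k + r) * 2 = 32 * k + 2 * r by ring, pow_add,
          pow_mul, pow_mul]
        norm_num
        ring
    _ ≤ (2 ^ 106) ^ k * 128 ^ r :=
        Nat.mul_le_mul (Nat.pow_le_pow_left (by norm_num) k) (Nat.pow_le_pow_left (by norm_num) r)
    _ = 2 ^ (16 * k + r) * (8 ^ (15 * k + r)) ^ 2 := by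
        rw [show (8 : ℕ) = 2 ^ 3 by norm_num, show (128 : ℕ) = 2 ^ 7 by norm_num, ← pow_mul,
          ← pow_mul, ← pow_mul, ← pow_mul, ← pow_add, ← pow_add]
        congr 1
        ring

theorem two_pow_le_mul_choose_half (n : ℕ) : 2 ^ n ≤ (n + 1) * n.choose (n / 2) := by
  rw [← Nat.sum_range_choose]
  calc _ ≤ ∑ _i ∈ range (n + 1), n.choose (n / 2) :=
        sum_le_sum fun i _ => Nat.choose_le_middle i n
    _ = _ := by simp

theorem twenty_mul_le_sixteen_pow {k : ℕ} (hk : 3 ≤ k) : 20 * (16 * k + 16) ≤ 16 ^ k := by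
  induction k, hk using Nat.le_induction with
  | base => norm_num
  | succ k _ ih => rw [pow_succ]; omega

/-- The members of `M` at Hamming distance at most `k` from `S`. -/
def nearby (M S : Finset (Finset (Fin n))) (k : ℕ) : Finset (Finset (Fin n)) :=
  M.filter fun x => ∃ y ∈ S, (x ∆ y).card ≤ k

theorem card_nearby_le (M S : Finset (Finset (Fin n))) (k : ℕ) :
    (nearby M S k).card ≤ S.card * ballCard n k := by
  classical
  calc (nearby M S k).card
      ≤ (S.biUnion fun y => univ.filter fun x => (x ∆ y).card ≤ k).card := by
        refine card_le_card fun x hx => ?_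
        obtain ⟨y, hy, hxy⟩ := (mem_filter.1 hx).2
        exact mem_biUnion.2 ⟨y, hy, mem_filter.2 ⟨mem_univ _, hxy⟩⟩
    _ ≤ S.card * ballCard n k := by
        refine card_biUnion_le_card_mul _ _ _ fun y _ => ?_
        refine card_le_card_of_injOn (fun x => x ∆ y) (fun x hx => ?_)
          (symmDiff_left_injective y).injOn
        simpa using hx

theorem ten_mul_card_nearby_le (hn : 48 ≤ n) (M S : Finset (Finset (Fin n)))
    (hM : M.card = n.choose (n / 2)) (hS : S.card ≤ ballCard n (n / 16) + 1) :
    10 * (nearby M S (n / 16)).card ≤ M.card := by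
  have h₁ := card_nearby_le M S (n / 16)
  have h₂ := ballCard_sq_mul_le n
  have h₃ := two_pow_le_mul_choose_half n
  have h₄ : 20 * (n + 1) ≤ 16 ^ (n / 16) :=
    le_trans (by omega) (twenty_mul_le_sixteen_pow (k := n / 16) (by omega))
  have hV : 1 ≤ ballCard n (n / 16) := card_pos.2 ⟨∅, by simp⟩
  rw [← hM] at h₃
  generalize ballCard n (n / 16) = V at *
  refine Nat.le_of_mul_le_mul_right (c := 16 ^ (n / 16)) ?_ (by positivity)
  calc 10 * (nearby M S (n / 16)).card * 16 ^ (n / 16)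
      ≤ 10 * ((V + V) * V) * 16 ^ (n / 16) := by
        gcongr
        exact h₁.trans (Nat.mul_le_mul_right _ (hS.trans (by omega)))
    _ = 20 * (V ^ 2 * 16 ^ (n / 16)) := by ring
    _ ≤ 20 * ((n + 1) * M.card) := Nat.mul_le_mul_left _ (h₂.trans h₃)
    _ = 20 * (n + 1) * M.card := by ring
    _ ≤ 16 ^ (n / 16) * M.card := Nat.mul_le_mul_right _ h₄
    _ = M.card * 16 ^ (n / 16) := mul_comm _ _

theorem isFar_twoLevel [NeZero n] {M S : Finset (Finset (Fin n))} {h : ℕ}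
    (hM : ∀ x ∈ M, x.card = h) (hSM : S ⊆ M) {x : Finset (Fin n)} (hx : x ∈ M)
    (hx' : x ∉ nearby M S (n / 16)) {ε : ℝ} (hε : ε ≤ 1 / 64) :
    IsFar ε (twoLevel x) (twoLevel '' (S : Set (Finset (Fin n)))) := by
  rintro _ ⟨y, hy, rfl⟩
  rw [variationDist_twoLevel ((hM x hx).trans (hM y (hSM hy)).symm)]
  have hd : n / 16 < (x ∆ y).card := by
    -- Distance above `n / 16` and denominator at most `4 * n` yield the threshold `1 / 64`.
    by_contra hle
    exact hx' (mem_filter.2 ⟨hx, y, hy, not_lt.1 hle⟩)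
  have hn : (0 : ℝ) < n := by exact_mod_cast NeZero.pos n
  have hxn : (x.card : ℝ) ≤ n := by exact_mod_cast (card_le_univ x).trans (by simp)
  have hd' : (n : ℝ) ≤ 16 * (x ∆ y).card := by
    have : n ≤ 16 * (x ∆ y).card := by omega
    exact_mod_cast this
  refine hε.trans ?_
  rw [le_div_iff₀ (by positivity)]
  linarith

theorem exists_perm_map_eq {x y : Finset (Fin n)} (h : x.card = y.card) :
    ∃ σ : Equiv.Perm (Fin n), x.map σ.toEmbedding = y := by
  have e : {i // i ∈ x} ≃ {i // i ∈ y} := Finset.equivOfCardEq h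
  refine ⟨e.extendSubtype, eq_of_subset_of_card_le (fun j hj => ?_) (by rw [card_map, h])⟩
  obtain ⟨i, hi, rfl⟩ := mem_map.1 hj
  exact e.extendSubtype_mem i hi

/-! ### The lower bound -/

/-- The low-degree approximant bounds the left side from above and the mean over `M` from below, and
its own two averages agree. -/
theorem sum_mul_acceptProb_le [NeZero n] {q : ℕ} {M S : Finset (Finset (Fin n))}
    {c : Finset (Fin n) → ℝ} (hc : ∀ x ∈ S, 0 ≤ c x) (hc1 : ∑ x ∈ S, c x = 1)
    (hf : ∀ f ∈ lowDegree n q, ∑ x ∈ S, c x * f x = (M.card : ℝ)⁻¹ * ∑ x ∈ M, f x)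
    {m : ℕ} (T : AdaptiveAlg n m) :
    ∑ x ∈ S, c x * acceptProb T x ≤
      (M.card : ℝ)⁻¹ * ∑ x ∈ M, acceptProb T x + 2 ^ m * (3 / 4) ^ q := by
  obtain ⟨f, hfq, hfx⟩ := exists_lowDegree_approx q T
  calc ∑ x ∈ S, c x * acceptProb T x
      ≤ ∑ x ∈ S, c x * (f x + 2 ^ m * (3 / 4) ^ q) :=
        sum_le_sum fun x hx => mul_le_mul_of_nonneg_left (hfx x).2 (hc x hx)
    _ = (M.card : ℝ)⁻¹ * ∑ x ∈ M, f x + 2 ^ m * (3 / 4) ^ q := by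
        simp only [mul_add, sum_add_distrib, ← sum_mul, hc1, one_mul, hf f hfq]
    _ ≤ _ := by
        have := sum_le_sum fun x (_ : x ∈ M) => (hfx x).1
        gcongr

/-- Averaging over the coin tosses preserves the inequality; the abstract `D` covers adaptive and
non-adaptive algorithms alike. -/
theorem sum_mul_toReal_bind_le [NeZero n] {q t : ℕ} {M S : Finset (Finset (Fin n))}
    {c : Finset (Fin n) → ℝ} (hc : ∀ x ∈ S, 0 ≤ c x) (hc1 : ∑ x ∈ S, c x = 1)
    (hf : ∀ f ∈ lowDegree n q, ∑ x ∈ S, c x * f x = (M.card : ℝ)⁻¹ * ∑ x ∈ M, f x)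
    {α : Type*} (T : PMF α) (D : α → PMF (Fin n) → PMF Bool)
    (hD : ∀ a, ∃ m ≤ t, ∃ A : AdaptiveAlg n m, ∀ μ, D a μ = A.run μ) :
    ∑ x ∈ S, c x * (T.bind (fun a => D a (twoLevel x)) true).toReal ≤
      (M.card : ℝ)⁻¹ * ∑ x ∈ M, (T.bind (fun a => D a (twoLevel x)) true).toReal +
        2 ^ t * (3 / 4) ^ q := by
  have hsum : ∀ x, HasSum (fun a => (T a).toReal * (D a (twoLevel x) true).toReal)
      (T.bind (fun a => D a (twoLevel x)) true).toReal := by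
    intro x
    rw [toReal_bind_apply]
    exact (Summable.of_nonneg_of_le
      (fun a => mul_nonneg ENNReal.toReal_nonneg ENNReal.toReal_nonneg)
      (fun a => mul_le_of_le_one_right ENNReal.toReal_nonneg (toReal_apply_le_one _ _))
      (summable_toReal T)).hasSum
  have hT : HasSum (fun a => (T a).toReal) 1 := tsum_toReal T ▸ (summable_toReal T).hasSum
  have hl := hasSum_sum fun x (_ : x ∈ S) => (hsum x).mul_left (c x)
  have hr := ((hasSum_sum fun x (_ : x ∈ M) => hsum x).mul_left (M.card : ℝ)⁻¹).add
    (hT.mul_right (2 ^ t * (3 / 4 : ℝ) ^ q))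
  rw [one_mul] at hr
  refine hasSum_le (fun a => ?_) hl hr
  obtain ⟨m, hm, A, hA⟩ := hD a
  have h := sum_mul_acceptProb_le hc hc1 hf A
  simp only [acceptProb, ← hA] at h
  have hmt : (2 : ℝ) ^ m * (3 / 4) ^ q ≤ 2 ^ t * (3 / 4) ^ q := by
    gcongr
    norm_num
  have h' := mul_le_mul_of_nonneg_left (h.trans (add_le_add_right hmt _))
    (ENNReal.toReal_nonneg (a := T a))
  rw [mul_add, mul_sum, mul_left_comm, mul_sum] at h'
  simpa only [mul_left_comm] using h'

/-- Three attempts per sample suffice since `2 * (3 / 4) ^ 3 < 1`; twelve more bring the error below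
`1 / 10`. -/
theorem two_pow_mul_three_quarters_pow_le {t q : ℕ} (h : 3 * t + 12 ≤ q) :
    (2 : ℝ) ^ t * (3 / 4) ^ q ≤ 1 / 10 := by
  calc (2 : ℝ) ^ t * (3 / 4) ^ q ≤ 2 ^ t * (3 / 4) ^ (3 * t + 12) :=
        mul_le_mul_of_nonneg_left (pow_le_pow_of_le_one (by norm_num) (by norm_num) h)
          (by positivity)
    _ = (27 / 32) ^ t * (3 / 4) ^ 12 := by
        rw [pow_add, pow_mul, ← mul_assoc, ← mul_pow]
        norm_num
    _ ≤ 1 * (3 / 4) ^ 12 := by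
        gcongr
        exact pow_le_one₀ (by norm_num) (by norm_num)
    _ ≤ 1 / 10 := by norm_num

theorem three_mul_add_twelve_lt_of_decidesProperty [NeZero n] {q t h : ℕ}
    {M S : Finset (Finset (Fin n))} {c : Finset (Fin n) → ℝ} (hM0 : M.Nonempty)
    (hM : ∀ x ∈ M, x.card = h) (hSM : S ⊆ M)
    (hc : ∀ x ∈ S, 0 ≤ c x) (hc1 : ∑ x ∈ S, c x = 1)
    (hf : ∀ f ∈ lowDegree n q, ∑ x ∈ S, c x * f x = (M.card : ℝ)⁻¹ * ∑ x ∈ M, f x)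
    (hnear : 10 * (nearby M S (n / 16)).card ≤ M.card)
    {ε δ : ℝ} (hε : ε ≤ 1 / 64) (hδ : δ ≤ 1 / 3)
    {α : Type*} (T : PMF α) (D : α → PMF (Fin n) → PMF Bool)
    (hD : ∀ a, ∃ m ≤ t, ∃ A : AdaptiveAlg n m, ∀ μ, D a μ = A.run μ)
    (hdec : DecidesProperty (twoLevel '' (S : Set (Finset (Fin n)))) ε δ
      fun μ => T.bind fun a => D a μ) :
    q < 3 * t + 12 := by
  classical
  by_contra! hq
  have hle := sum_mul_toReal_bind_le hc hc1 hf T D hD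
  have hB := two_pow_mul_three_quarters_pow_le hq
  set p : Finset (Fin n) → ℝ := fun x => (T.bind (fun a => D a (twoLevel x)) true).toReal with hp
  have hacc : 2 / 3 ≤ ∑ x ∈ S, c x * p x :=
    calc (2 / 3 : ℝ) = ∑ x ∈ S, c x * (2 / 3) := by rw [← sum_mul, hc1, one_mul]
      _ ≤ ∑ x ∈ S, c x * p x := sum_le_sum fun x hx => mul_le_mul_of_nonneg_left
          (by have := hdec.1 _ ⟨x, hx, rfl⟩; simp only [hp]; linarith) (hc x hx)
  have hrej : ∀ x ∈ M, p x ≤ 1 / 3 + if x ∈ nearby M S (n / 16) then 1 else 0 := by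
    intro x hx
    split_ifs with hx'
    · linarith [toReal_apply_le_one (T.bind fun a => D a (twoLevel x)) true]
    · have h₁ := hdec.2 _ (isFar_twoLevel hM hSM hx hx' hε)
      have h₂ := toReal_true_add_toReal_false (T.bind fun a => D a (twoLevel x))
      simp only [hp]
      linarith
  have hsum : ∑ x ∈ M, p x ≤ M.card * (1 / 3) + (nearby M S (n / 16)).card := by
    refine (sum_le_sum hrej).trans_eq ?_
    rw [sum_add_distrib, sum_const, nsmul_eq_mul, sum_ite_mem,
      inter_eq_right.2 (show nearby M S (n / 16) ⊆ M from filter_subset _ _),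
      sum_const, nsmul_eq_mul, mul_one]
  have hMpos : (0 : ℝ) < M.card := by exact_mod_cast hM0.card_pos
  have hnear' : (10 : ℝ) * (nearby M S (n / 16)).card ≤ M.card := by exact_mod_cast hnear
  have hmean : (M.card : ℝ)⁻¹ * ∑ x ∈ M, p x ≤ 1 / 3 + 1 / 10 := by
    rw [inv_mul_le_iff₀ hMpos]
    linarith
  -- The contradiction is `2 / 3 ≤ 1 / 3 + 1 / 10 + 1 / 10`: tester error, members of `M` near `S`,
  -- and approximation error.
  linarith

/-- Some `x` in `M` is far from `S`, yet a permutation carries any member of `S` to it, as all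
members of `M` have equal size. -/
theorem not_labelInvariant [NeZero n] {h : ℕ} {M S : Finset (Finset (Fin n))}
    (hM0 : M.Nonempty) (hS0 : S.Nonempty) (hM : ∀ x ∈ M, x.card = h) (hSM : S ⊆ M)
    (hnear : 10 * (nearby M S (n / 16)).card ≤ M.card) :
    ¬ LabelInvariant (twoLevel '' (S : Set (Finset (Fin n)))) := by
  intro hinv
  obtain ⟨x, hx, hx'⟩ : ∃ x ∈ M, x ∉ nearby M S (n / 16) := by
    by_contra! hall
    have := card_le_card hall
    have := hM0.card_pos
    omega
  obtain ⟨y, hy⟩ := hS0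
  obtain ⟨σ, hσ⟩ := exists_perm_map_eq ((hM y (hSM hy)).trans (hM x hx).symm)
  have hmem := hinv _ ⟨y, hy, rfl⟩ σ
  rw [map_twoLevel, hσ] at hmem
  have := isFar_twoLevel hM hSM hx hx' le_rfl _ hmem
  rw [variationDist_twoLevel rfl] at this
  norm_num at this

theorem exists_hard_property (hn : 1600 ≤ n) :
    ∃ P : Set (PMF (Fin n)), ¬ LabelInvariant P ∧
      ∀ ε δ : ℝ, ε ≤ 1 / 64 → δ ≤ 1 / 3 → ∀ (t : ℕ) {α : Type} (T : PMF α)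
        (D : α → PMF (Fin n) → PMF Bool),
        (∀ a, ∃ m ≤ t, ∃ A : AdaptiveAlg n m, ∀ μ, D a μ = A.run μ) →
        DecidesProperty P ε δ (fun μ => T.bind fun a => D a μ) →
        1 / 100 * (n : ℝ) ≤ t := by
  have : NeZero n := ⟨by omega⟩
  let M : Finset (Finset (Fin n)) := powersetCard (n / 2) univ
  have hM : ∀ x ∈ M, x.card = n / 2 := fun x hx => (mem_powersetCard.1 hx).2
  have hMcard : M.card = n.choose (n / 2) := by simp [M]
  have hM0 : M.Nonempty := card_pos.1 (hMcard ▸ Nat.choose_pos (Nat.div_le_self n 2))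
  obtain ⟨S, hSM, hS, c, hc, hc1, hf⟩ := exists_small_support_of_lowDegree (n / 16) hM0
  have hS0 : S.Nonempty := by
    rw [nonempty_iff_ne_empty]
    rintro rfl
    simp at hc1
  have hnear := ten_mul_card_nearby_le (by omega) M S hMcard hS
  refine ⟨twoLevel '' (S : Set (Finset (Fin n))), not_labelInvariant hM0 hS0 hM hSM hnear,
    fun ε δ hε hδ t α T D hD hdec => ?_⟩
  have hlt := three_mul_add_twelve_lt_of_decidesProperty hM0 hM hSM hc hc1 hf hnear hε hδ T D hD
    hdec
  -- From `n / 16 < 3 * t + 12` follows `n < 48 * t + 192`, and `1600 ≤ n` absorbs the constant.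
  have hnt : n ≤ 100 * t := by omega
  have : (n : ℝ) ≤ 100 * t := by exact_mod_cast hnt
  linarith

end CondSampling

end

theorem mainTheorem12 :
    ∃ (P : (n : ℕ) → Set (PMF (Fin n))) (ε₀ c : ℝ) (N : ℕ), 0 < ε₀ ∧ 0 < c ∧
      ∀ n : ℕ, N ≤ n →
        ¬ CondSampling.LabelInvariant (P n) ∧
        ∀ ε δ : ℝ, 0 < ε → ε ≤ ε₀ → 0 < δ → δ ≤ 1 / 3 →
          (∀ (t : ℕ) (T : PMF (CondSampling.AdaptiveAlg n t)),
            CondSampling.IsAdaptiveTester (P n) ε δ T → c * (n : ℝ) ≤ (t : ℝ)) ∧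
          (∀ (t : ℕ) (T : PMF (CondSampling.NonadaptiveAlg n t)),
            CondSampling.IsNonadaptiveTester (P n) ε δ T → c * (n : ℝ) ≤ (t : ℝ)) := by
  classical
  refine ⟨fun n => if hn : 1600 ≤ n then (CondSampling.exists_hard_property hn).choose else ∅,
    1 / 64, 1 / 100, 1600, by norm_num, by norm_num, fun n hn => ?_⟩
  simp only [dif_pos hn]
  obtain ⟨hinv, hhard⟩ := (CondSampling.exists_hard_property hn).choose_spec
  refine ⟨hinv, fun ε δ _ hε _ hδ => ⟨fun t T hT => ?_, fun t T hT => ?_⟩⟩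
  · exact hhard ε δ hε hδ t T (fun a μ => a.run μ) (fun a => ⟨t, le_rfl, a, fun _ => rfl⟩) hT
  · exact hhard ε δ hε hδ t T (fun a μ => a.run μ)
      (fun a => ⟨a.numSamples, a.numSamples_le, CondSampling.treeOfSets a.sets a.decide,
        fun μ => (CondSampling.run_treeOfSets μ a.sets a.decide).symm⟩) hT
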